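/- Tile types are (non-rotatable) unit squares with a glue label on each of their four sides, each glue label having a fixed strength in $\mathbb{N}$; two tiles at adjacent points of $\mathbb{Z}^2$ bind, with the strength of the common label, if their labels on the abutting sides are equal. An assembly is a partial function from $\mathbb{Z}^2$ to a set of tile types. An aTAM system is a triple $\mathcal{T}=(T,\sigma,\tau)$ with $T$ a finite set of tile types, $\tau\in\mathbb{N}$ a temperature, and $\sigma$ a seed: a finite assembly that is $\tau$-stable, i.e. for every partition of its domain into two nonempty parts the strengths of the bonds between the two parts add up to at least $\tau$. A tile may be added to an assembly at an empty point if its bonds with the neighbouring tiles have total strength at least $\tau$. An assembly is producible if it is obtained from $\sigma$ by finitely many such additions. An assembly $\alpha$ can grow into $\beta$ if $\beta$ is the result (the last assembly or, for an infinite sequence, the limit) of a finite or infinite sequence of such additions starting from $\alpha$. The system $\mathcal{T}$ finitely self-assembles a set $X\subseteq\mathbb{Z}^2$ if every finite producible assembly of $\mathcal{T}$ can grow into an assembly whose domain is exactly $X$. Let $G=\{(0,0),(0,1),(0,2),(1,0),(2,0),(2,1),(2,2)\}$. The U fractal is the discrete self-similar fractal $\mathbf{U}=\bigcup_{i\ge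 1}U_i\subset\mathbb{N}^2\subset\mathbb{Z}^2$ with generator $G$, where $U_1=G$ and $U_{i+1}=\{a+3^i b : a\in U_i,\ b\in G\}$. **Theorem.** No aTAM system finitely self-assembles the U fractal $\mathbf{U}$. -/

import Mathlib

/-! ## The abstract Tile Assembly Model (aTAM) -/

/-- The four sides of a unit square. -/
inductive Side : Type
  | north
  | east
  | south
  | west

namespace Side

/-- The side of the neighbouring square that abuts a given side. -/
def opp : Side → Side
  | north => south
  | east => west
  | south => north
  | west => east

/-- The unit vector pointing from a square to its neighbour across a given side. -/
def vec : Side → ℤ × ℤ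
  | north => (0, 1)
  | east => (1, 0)
  | south => (0, -1)
  | west => (-1, 0)

end Side

/-- A tile type: a unit square (not rotatable) with a glue label on each of its four sides.
The strength of a glue is determined by its label and is recorded in the tile assembly system. -/
structure TileType (L : Type*) where
  glue : Side → L

/-- An assembly of tiles from `T`: a partial function from `ℤ²` to `T`. -/
abbrev Assembly (T : Type*) : Type _ := ℤ × ℤ → Option T

namespace Assembly

/-- The domain of an assembly: the set of points that carry a tile. -/
def dom {T : Type*} (a : Assembly T) : Set (ℤ × ℤ) := {p | (a p).isSome}

open Classical in
/-- The strength with which the two tiles at `p` and at its neighbour across the side `d`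
are bound in the assembly `a`: the strength of the common glue label if both tiles are present
and their labels on the abutting sides are equal, and `0` otherwise. The two tiles are joined by
an edge of the binding graph iff this number is positive, and it is then the weight of the edge. -/
noncomputable def bond {L : Type*} {S : Finset (TileType L)} (strength : L → ℕ)
    (a : Assembly S) (p : ℤ × ℤ) (d : Side) : ℕ :=
  match a p, a (p + d.vec) with
  | some t, some t' => if t.1.glue d = t'.1.glue d.opp then strength (t.1.glue d) else 0
  | _, _ => 0

/-- The total strength of all bonds of the tile at `p` with its four neighbours. -/
noncomputable def bondSum {L : Type*} {S : Finset (TileType L)} (strength : L → ℕ)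
    (a : Assembly S) (p : ℤ × ℤ) : ℕ :=
  a.bond strength p .north + a.bond strength p .east
    + a.bond strength p .south + a.bond strength p .west

open Classical in
/-- The strength of the cut of the binding graph of `a` that separates the points of the finite
set `A` from the other points of the domain: the sum of the strengths of the bonds across it. -/
noncomputable def cutStrength {L : Type*} {S : Finset (TileType L)} (strength : L → ℕ)
    (a : Assembly S) (A : Finset (ℤ × ℤ)) : ℕ :=
  ∑ p ∈ A,
    ((if p + Side.north.vec ∈ A then 0 else a.bond strength p .north)
      + (if p + Side.east.vec ∈ A then 0 else a.bond strength p .east)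
      + (if p + Side.south.vec ∈ A then 0 else a.bond strength p .south)
      + (if p + Side.west.vec ∈ A then 0 else a.bond strength p .west))

/-- A finite assembly is `τ`-stable if every cut of its binding graph, that is, every
partition of its domain into two nonempty parts, has strength at least `τ`. -/
def FiniteStable {L : Type*} {S : Finset (TileType L)} (strength : L → ℕ) (τ : ℕ)
    (a : Assembly S) : Prop :=
  a.dom.Finite ∧ ∀ A : Finset (ℤ × ℤ), A.Nonempty → (A : Set (ℤ × ℤ)) ⊂ a.dom →
    τ ≤ a.cutStrength strength A

end Assembly

/-- A tile assembly system of the aTAM, with glue labels in `L`: a finite set of tile types,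
a strength for each glue label, a temperature, and a finite seed assembly that is stable
at that temperature. -/
structure TAS (L : Type*) where
  tiles : Finset (TileType L)
  strength : L → ℕ
  temp : ℕ
  seed : Assembly tiles
  seed_stable : seed.FiniteStable strength temp

namespace TAS

/-- `b` is obtained from `a` by the stable binding of a single tile: a tile is added at an empty
point, and the strengths of its bonds with the tiles already present add up to at least
the temperature. -/
def Step {L : Type*} (𝒯 : TAS L) (a b : Assembly 𝒯.tiles) : Prop :=
  ∃ (p : ℤ × ℤ) (t : 𝒯.tiles), a p = none ∧ b = Function.update a p (some t) ∧
    𝒯.temp ≤ b.bondSum 𝒯.strength p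

/-- An assembly is producible if it is obtained from the seed by finitely many
single-tile attachments. -/
def Producible {L : Type*} (𝒯 : TAS L) (a : Assembly 𝒯.tiles) : Prop :=
  Relation.ReflTransGen 𝒯.Step 𝒯.seed a

/-- `a` can grow into `b`: there is an assembly sequence, finite or infinite, that starts at `a`
and has result `b`. The result of a finite sequence is its last assembly, and the result of
an infinite sequence is its limit (the union of its assemblies). -/
def GrowsInto {L : Type*} (𝒯 : TAS L) (a b : Assembly 𝒯.tiles) : Prop :=
  Relation.ReflTransGen 𝒯.Step a b ∨
    ∃ f : ℕ → Assembly 𝒯.tiles, f 0 = a ∧ (∀ n, 𝒯.Step (f n) (f (n + 1))) ∧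
      ∀ p t, b p = some t ↔ ∃ n, f n p = some t

/-- `𝒯` finitely self-assembles the shape `X` if every finite producible assembly can grow into
an assembly that has tiles exactly on the points of `X`. -/
def FinitelySelfAssembles {L : Type*} (𝒯 : TAS L) (X : Set (ℤ × ℤ)) : Prop :=
  ∀ a : Assembly 𝒯.tiles, 𝒯.Producible a → a.dom.Finite →
    ∃ b : Assembly 𝒯.tiles, 𝒯.GrowsInto a b ∧ b.dom = X

end TAS

/-! ## Discrete self-similar fractals -/

namespace DSSF

/-- The width `w_G` of a generator: the largest first coordinate plus one. -/
def width (G : Finset (ℕ × ℕ)) : ℕ := G.sup Prod.fst + 1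

/-- The height `h_G` of a generator: the largest second coordinate plus one. -/
def height (G : Finset (ℕ × ℕ)) : ℕ := G.sup Prod.snd + 1

/-- The set `A + (x, y) B = {a + (x * b₁, y * b₂) | a ∈ A, b ∈ B}`. -/
def scaledAdd (A : Set (ℕ × ℕ)) (x y : ℕ) (B : Set (ℕ × ℕ)) : Set (ℕ × ℕ) :=
  {p | ∃ a ∈ A, ∃ b ∈ B, p = (a.1 + x * b.1, a.2 + y * b.2)}

/-- The stages of the fractal with generator `G`; `stage G i` is the stage `X_(i+1)`, where
`X_1 = G` and `X_(i+1) = X_i + (w_G ^ i, h_G ^ i) G`. -/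
def stage (G : Finset (ℕ × ℕ)) : ℕ → Set (ℕ × ℕ)
  | 0 => (G : Set (ℕ × ℕ))
  | i + 1 => scaledAdd (stage G i) (width G ^ (i + 1)) (height G ^ (i + 1)) G

/-- The discrete self-similar fractal with generator `G`: the union of all its stages. -/
def fractal (G : Finset (ℕ × ℕ)) : Set (ℕ × ℕ) := ⋃ i, stage G i

/-- The generator of the U fractal. -/
def uGenerator : Finset (ℕ × ℕ) := {(0, 0), (0, 1), (0, 2), (1, 0), (2, 0), (2, 1), (2, 2)}

/-- The U fractal, as a set of points of the first quadrant of `ℤ²`. -/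
def uFractal : Set (ℤ × ℤ) := (fun p : ℕ × ℕ => ((p.1 : ℤ), (p.2 : ℤ))) '' fractal uGenerator

end DSSF

/-! At scale `j`, consider the block `[3 ^ (j + 1), 2 * 3 ^ (j + 1)) × [0, 3 ^ (j + 1))`. Inside it,
the middle column of the left arm meets the fractal only at the heights `0`, `3 ^ j`, `2 * 3 ^ j`,
and the middle column of the whole block only at height `0`. These four cut points are the only
gates of the left inner lobe between the two columns; its mirror image shares the last gate. When
the shared gate is filled, a neighbour in one of the two lobes is already present, and it is the
only point of that lobe adjacent to the gate. Hence nothing enters that lobe through the shared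
gate: all its tiles grow from its three other cut points.

Growth that depends on a single cut tile can be replayed at any other scale where the same tile can
occur at the corresponding cut point with enough empty space beside it. By pigeonhole there are
scales `i < j < j'` with the same side and the same sets `cutTiles`. Replaying at the smaller scale
`i` confines the growth from the two upper cut points of lobe `j` to tiny boxes, because lobe `i`
has a hole just beyond them. Replaying at the larger scale `j'` keeps the growth from the lowest cut
point below height `3 ^ j`, because lobe `j'` has a hole there. Thus the three growths never meet
(`confined`), and the fractal point `(repunit j, 3 ^ j)` of lobe `j` is never filled.

Replaying rests on `producible_restrict`, which empties a region, and `producible_merge`, which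
pastes a translated growth; `not_leave` turns a paste that leaves the fractal into a contradiction.
-/

/-- Membership in the U fractal, read off from base-three digits: `G` consists of all pairs of
digits other than `(1, 1)` and `(1, 2)`. -/
def InU (x y : ℤ) : Prop := 0 ≤ x ∧ 0 ≤ y ∧ ∀ k : ℕ, x / 3 ^ k % 3 = 1 → y / 3 ^ k % 3 = 0

/-- The number with base-three expansion `1⋯1` (`j` digits). -/
def repunit : ℕ → ℤ
  | 0 => 0
  | j + 1 => 3 ^ j + repunit j

/-! ### Base-three digits and the geometry they encode -/

theorem two_mul_repunit (j : ℕ) : 2 * repunit j + 1 = 3 ^ j := by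
  induction j with
  | zero => simp [repunit]
  | succ j ih => rw [repunit, pow_succ]; linarith

theorem repunit_nonneg (j : ℕ) : 0 ≤ repunit j := by
  have := two_mul_repunit j
  have : (0 : ℤ) < 3 ^ j := by positivity
  omega

theorem pow_three_lt {i j : ℕ} (h : i < j) : 3 * (3 : ℤ) ^ i ≤ 3 ^ j := by
  have : (3 : ℤ) ^ (i + 1) ≤ 3 ^ j := pow_le_pow_right₀ (by norm_num) h
  rwa [pow_succ, mul_comm] at this

theorem repunit_split {k j : ℕ} (h : k < j) :
    ∃ a : ℤ, repunit j = a * 3 ^ (k + 1) + 3 ^ k + repunit k := by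
  induction j, h using Nat.le_induction with
  | base => exact ⟨0, by simp [repunit]⟩
  | succ j hj ih =>
    obtain ⟨a, ha⟩ := ih
    obtain ⟨c, rfl⟩ := Nat.exists_eq_add_of_le hj
    refine ⟨a + 3 ^ c, ?_⟩
    rw [repunit, ha, pow_add]
    simp only [Nat.succ_eq_add_one]
    ring

theorem digit_eq {x a d r : ℤ} {k : ℕ} (hx : x = a * 3 ^ (k + 1) + d * 3 ^ k + r)
    (hd0 : 0 ≤ d) (hd : d < 3) (hr0 : 0 ≤ r) (hr : r < 3 ^ k) : x / 3 ^ k % 3 = d := by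
  have h : x / 3 ^ k = a * 3 + d := by
    have : x = r + (a * 3 + d) * 3 ^ k := by rw [hx, pow_succ]; ring
    rw [this, Int.add_mul_ediv_right _ _ (by positivity), Int.ediv_eq_zero_of_lt hr0 hr, zero_add]
  rw [h]; omega

theorem not_inU {x y a r a' d r' : ℤ} (k : ℕ) (hx : x = a * 3 ^ (k + 1) + 3 ^ k + r)
    (hr0 : 0 ≤ r) (hr : r < 3 ^ k) (hy : y = a' * 3 ^ (k + 1) + d * 3 ^ k + r')
    (hd0 : 1 ≤ d) (hd : d < 3) (hr0' : 0 ≤ r') (hr' : r' < 3 ^ k) : ¬ InU x y := by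
  rintro ⟨-, -, h⟩
  have h1 := h k (digit_eq (a := a) (d := 1) (by linarith) (by norm_num) (by norm_num) hr0 hr)
  rw [digit_eq hy (by omega) hd hr0' hr'] at h1
  omega

theorem pow_dvd_of_digits {y : ℤ} {j : ℕ} (h : ∀ k < j, y / 3 ^ k % 3 = 0) : (3 : ℤ) ^ j ∣ y := by
  induction j with
  | zero => simp
  | succ j ih =>
    obtain ⟨c, rfl⟩ := ih fun k hk => h k (by omega)
    have h1 := h j (by omega)
    rw [Int.mul_ediv_cancel_left _ (by positivity)] at h1
    rw [pow_succ]
    exact mul_dvd_mul_left _ (Int.dvd_of_emod_eq_zero h1)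

/-- The last `j` digits of the abscissa are all `1`, so those of `y` all vanish. This is what makes
middle columns consist of isolated cut points. -/
theorem InU.pow_dvd {j : ℕ} {a y : ℤ} (h : InU (a * 3 ^ j + repunit j) y) : (3 : ℤ) ^ j ∣ y := by
  refine pow_dvd_of_digits fun k hk => h.2.2 k ?_
  obtain ⟨c, hc⟩ := repunit_split hk
  obtain ⟨m, rfl⟩ := Nat.exists_eq_add_of_lt hk
  have h0 := repunit_nonneg k
  have h2 := two_mul_repunit k
  refine digit_eq (a := a * 3 ^ m + c) (d := 1) (r := repunit k) ?_ (by norm_num) (by norm_num) h0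
    (by omega)
  rw [hc, show k + m + 1 = m + (k + 1) by ring, pow_add]
  ring

theorem inU_zero {x : ℤ} (hx : 0 ≤ x) : InU x 0 := ⟨hx, le_rfl, by simp⟩

/-- Reflecting the block replaces each digit `d` below position `j + 1` by `2 - d`, which preserves
being `1`, and leaves higher digits alone. It allows both inner lobes to be treated at once. -/
theorem InU.mirror {j : ℕ} {w y : ℤ} (h0 : 0 ≤ w) (h1 : w < 3 ^ (j + 1))
    (h : InU (3 ^ (j + 1) + w) y) : InU (3 ^ (j + 1) + (3 ^ (j + 1) - 1 - w)) y := by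
  refine ⟨by omega, h.2.1, fun k hk => h.2.2 k ?_⟩
  rcases Nat.lt_or_ge k (j + 1) with hkj | hkj
  · obtain ⟨m, hm⟩ := Nat.exists_eq_add_of_lt hkj
    have hp : (0 : ℤ) < 3 ^ k := by positivity
    have e : (3 : ℤ) ^ (j + 1) = 3 ^ m * 3 ^ (k + 1) := by
      rw [← pow_add]; congr 1; omega
    have d0 := Int.emod_nonneg (w / 3 ^ k) (by norm_num : (3 : ℤ) ≠ 0)
    have d1 := Int.emod_lt_of_pos (w / 3 ^ k) (by norm_num : (0 : ℤ) < 3)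
    have r0 := Int.emod_nonneg w hp.ne'
    have r1 := Int.emod_lt_of_pos w hp
    have e1 := Int.mul_ediv_add_emod w (3 ^ k)
    have e2 := Int.mul_ediv_add_emod (w / 3 ^ k) 3
    set d := w / 3 ^ k % 3
    set r := w % 3 ^ k
    set a := w / 3 ^ k / 3
    have ew : w = a * 3 ^ (k + 1) + d * 3 ^ k + r := by
      rw [← e1, ← e2, pow_succ]; ring
    rw [digit_eq (a := 2 * 3 ^ m - 1 - a) (d := 2 - d) (r := 3 ^ k - 1 - r)
      (by rw [e, ew, pow_succ]; ring) (by omega) (by omega) (by omega) (by omega)] at hk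
    exact (digit_eq (a := 3 ^ m + a) (by rw [e, ew]; ring) d0 d1 r0 r1).trans (by omega)
  · obtain ⟨m, rfl⟩ := Nat.exists_eq_add_of_le hkj
    rw [pow_add _ (j + 1) m, ← Int.ediv_ediv_of_nonneg (by positivity)] at hk ⊢
    have e : ∀ v : ℤ, 0 ≤ v → v < 3 ^ (j + 1) → (3 ^ (j + 1) + v) / 3 ^ (j + 1) = 1 := by
      intro v hv0 hv1
      rw [Int.add_ediv_of_dvd_left dvd_rfl, Int.ediv_self (by positivity),
        Int.ediv_eq_zero_of_lt hv0 hv1, add_zero]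
    rw [e _ (by omega) (by omega)] at hk
    rw [e _ h0 h1]
    exact hk

/-! ### The fractal in terms of base-three digits -/

namespace DSSF

theorem width_uGenerator : width uGenerator = 3 := by decide
theorem height_uGenerator : height uGenerator = 3 := by decide

theorem mem_uGenerator {b : ℕ × ℕ} :
    b ∈ uGenerator ↔ b.1 < 3 ∧ b.2 < 3 ∧ (b.1 = 1 → b.2 = 0) := by
  obtain ⟨x, y⟩ := b
  simp only [uGenerator, Finset.mem_insert, Finset.mem_singleton, Prod.mk.injEq]
  omega

theorem mem_stage {i : ℕ} {x y : ℕ} : (x, y) ∈ stage uGenerator i ↔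
    x < 3 ^ (i + 1) ∧ y < 3 ^ (i + 1) ∧ ∀ k ≤ i, x / 3 ^ k % 3 = 1 → y / 3 ^ k % 3 = 0 := by
  induction i generalizing x y with
  | zero =>
    simp only [stage, Finset.mem_coe, mem_uGenerator]
    simp
    intro hx hy
    rw [Nat.mod_eq_of_lt hx, Nat.mod_eq_of_lt hy]
  | succ i ih =>
    have hp : 0 < 3 ^ (i + 1) := by positivity
    have hlow : ∀ k ≤ i, ∀ a b : ℕ, (a + 3 ^ (i + 1) * b) / 3 ^ k % 3 = a / 3 ^ k % 3 := by
      intro k hk a b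
      obtain ⟨m, rfl⟩ := Nat.exists_eq_add_of_le hk
      rw [show a + 3 ^ (k + m + 1) * b = a + 3 ^ k * (3 * (3 ^ m * b)) by ring,
        Nat.add_mul_div_left _ _ (by positivity), Nat.add_mul_mod_self_left]
    have hhigh : ∀ a b : ℕ, a < 3 ^ (i + 1) → (a + 3 ^ (i + 1) * b) / 3 ^ (i + 1) = b := by
      intro a b ha
      rw [Nat.add_mul_div_left _ _ hp, Nat.div_eq_of_lt ha, zero_add]
    simp only [stage, scaledAdd, width_uGenerator, height_uGenerator, Set.mem_ofPred_eq,
      Finset.mem_coe, mem_uGenerator, Prod.exists, Prod.mk.injEq]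
    constructor
    · rintro ⟨a, b, hab, c, d, ⟨hc, hd, hcd⟩, rfl, rfl⟩
      obtain ⟨ha, hb, h⟩ := ih.1 hab
      refine ⟨by rw [pow_succ 3 (i + 1)]; nlinarith, by rw [pow_succ 3 (i + 1)]; nlinarith,
        fun k hk => ?_⟩
      rcases Nat.lt_or_ge i k with h1 | h1
      · obtain rfl : k = i + 1 := by omega
        rw [hhigh _ _ ha, hhigh _ _ hb, Nat.mod_eq_of_lt hc, Nat.mod_eq_of_lt hd]
        exact hcd
      · rw [hlow k h1, hlow k h1]
        exact h k h1
    · rintro ⟨hx, hy, h⟩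
      have ex := Nat.mod_add_div x (3 ^ (i + 1))
      have ey := Nat.mod_add_div y (3 ^ (i + 1))
      have hx3 : x / 3 ^ (i + 1) < 3 := Nat.div_lt_of_lt_mul (by rwa [← pow_succ])
      have hy3 : y / 3 ^ (i + 1) < 3 := Nat.div_lt_of_lt_mul (by rwa [← pow_succ])
      refine ⟨x % 3 ^ (i + 1), y % 3 ^ (i + 1), ih.2 ⟨Nat.mod_lt _ hp, Nat.mod_lt _ hp, ?_⟩,
        x / 3 ^ (i + 1), y / 3 ^ (i + 1), ⟨hx3, hy3, ?_⟩, ex.symm, ey.symm⟩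
      · intro k hk h1
        rw [← hlow k hk _ (x / 3 ^ (i + 1)), ex] at h1
        rw [← hlow k hk _ (y / 3 ^ (i + 1)), ey]
        exact h k (by omega) h1
      · have := h (i + 1) le_rfl
        rwa [Nat.mod_eq_of_lt hx3, Nat.mod_eq_of_lt hy3] at this

theorem mem_uFractal {p : ℤ × ℤ} : p ∈ uFractal ↔ InU p.1 p.2 := by
  obtain ⟨px, py⟩ := p
  simp only [uFractal, fractal, Set.mem_image, Set.mem_iUnion, Prod.exists, mem_stage,
    Prod.mk.injEq]
  have cast : ∀ x k : ℕ, ((x : ℤ) / 3 ^ k % 3) = ((x / 3 ^ k % 3 : ℕ) : ℤ) := by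
    intro x k; push_cast; rfl
  constructor
  · rintro ⟨x, y, ⟨i, hx, hy, h⟩, rfl, rfl⟩
    refine ⟨by positivity, by positivity, fun k hk => ?_⟩
    simp only [cast] at hk ⊢
    rcases Nat.lt_or_ge i k with h1 | h1
    · have : y < 3 ^ k := hy.trans_le (Nat.pow_le_pow_right (by norm_num) h1)
      rw [Nat.div_eq_of_lt this]; rfl
    · exact_mod_cast h k h1 (by exact_mod_cast hk)
  · rintro ⟨hx, hy, h⟩
    lift px to ℕ using hx
    lift py to ℕ using hy
    -- Any sufficiently late stage works; `px + py` is late enough because `n < 3 ^ n`.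
    refine ⟨px, py, ⟨px + py, ?_, ?_, fun k _ hk => ?_⟩, rfl, rfl⟩
    · exact lt_of_lt_of_le (Nat.lt_pow_self (by norm_num : 1 < 3))
        (Nat.pow_le_pow_right (by norm_num) (by omega))
    · exact lt_of_lt_of_le (Nat.lt_pow_self (by norm_num : 1 < 3))
        (Nat.pow_le_pow_right (by norm_num) (by omega))
    · have := h k (by rw [cast, hk]; rfl)
      rw [cast] at this
      exact_mod_cast this

theorem infinite_uFractal : uFractal.Infinite := by
  refine Set.infinite_of_injective_forall_mem (f := fun n : ℕ => ((n : ℤ), (0 : ℤ))) ?_ ?_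
  · intro a b h
    simpa using h
  · exact fun n => mem_uFractal.2 (inU_zero (by positivity))

end DSSF

/-! ### The inner lobes of a block

The block `[3 ^ (j + 1), 2 * 3 ^ (j + 1)) × [0, 3 ^ (j + 1))` has nothing above or below it.
`LobeMem j u y` says that the point at horizontal distance `u` from the column through the cut
points `(0, m * 3 ^ j)` of its left inner lobe belongs to the fractal. -/

/-- Membership in the U fractal in the coordinates of the left inner lobe of scale `j`. -/
def LobeMem (j : ℕ) (u y : ℤ) : Prop := InU (3 ^ (j + 1) + repunit j + u) y

namespace LobeMem

variable {i j : ℕ} {u y m : ℤ}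

theorem nonneg (h : LobeMem j u y) : 0 ≤ y := h.2.1

theorem not_top (h0 : 0 ≤ u) (h1 : u ≤ 3 ^ j) : ¬ LobeMem j u (3 ^ (j + 1)) := by
  have := repunit_nonneg j
  have := two_mul_repunit j
  exact not_inU (a := 0) (r := repunit j + u) (a' := 0) (d := 1) (r' := 0) (j + 1) (by ring)
    (by omega) (by rw [pow_succ]; omega) (by ring) le_rfl (by norm_num) le_rfl (by positivity)

theorem eq_mul_of_zero (h : LobeMem j 0 y) (hy : y < 3 ^ (j + 1)) :
    y = 0 ∨ y = 3 ^ j ∨ y = 2 * 3 ^ j := by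
  have h0 := h.nonneg
  have : InU (3 * 3 ^ j + repunit j) y := by
    have := h; unfold LobeMem at this; rwa [add_zero, pow_succ, mul_comm] at this
  obtain ⟨c, rfl⟩ := this.pow_dvd
  have hp : (0 : ℤ) < 3 ^ j := by positivity
  rw [pow_succ] at hy
  have : 0 ≤ c := nonneg_of_mul_nonneg_right h0 hp
  have : c < 3 := lt_of_mul_lt_mul_left hy hp.le
  interval_cases c <;> simp [mul_comm]

theorem eq_zero_of_right (h : LobeMem j (3 ^ j) y) (hy : y < 3 ^ (j + 1)) : y = 0 := by
  have : InU (1 * 3 ^ (j + 1) + repunit (j + 1)) y := by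
    have := h; unfold LobeMem at this
    rw [repunit]; convert this using 1; ring
  exact Int.eq_zero_of_dvd_of_nonneg_of_lt h.nonneg hy this.pow_dvd

theorem right_zero (j : ℕ) : LobeMem j (3 ^ j) 0 :=
  inU_zero (by have := repunit_nonneg j; positivity)

/-- Digit `j - 1` of the abscissa is `1` and that of the ordinate is `2`. The gap `i + 2 ≤ j` keeps
`repunit (j - 1) + u` below `3 ^ (j - 1)`, so no carry spoils the digit `1`. -/
theorem not_below (hij : i + 2 ≤ j) (h0 : 0 ≤ u) (h1 : u ≤ repunit i + 1) :
    ¬ LobeMem j u (m * 3 ^ j - 1) := by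
  obtain ⟨j, rfl⟩ : ∃ l, j = l + 1 := ⟨j - 1, by omega⟩
  have := pow_three_lt (show i < j by omega)
  have := repunit_nonneg j
  have := two_mul_repunit j
  have := two_mul_repunit i
  have : (0 : ℤ) < 3 ^ i := by positivity
  exact not_inU (a := 3) (r := repunit j + u) (a' := m - 1) (d := 2) (r' := 3 ^ j - 1) j
    (by rw [repunit]; ring) (by omega) (by omega) (by ring) (by norm_num) (by norm_num)
    (by omega) (by omega)

/-- Since `repunit i + u < 3 ^ i`, digit `i` of the abscissa is still `1`, while digit `i` of the
ordinate is `1`. The case `m = 0` also provides the hole that stops the low growth at a larger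
scale. -/
theorem not_above (hij : i < j) (h0 : 0 ≤ u) (h1 : u ≤ repunit i) :
    ¬ LobeMem j u (m * 3 ^ j + 3 ^ i) := by
  obtain ⟨a, ha⟩ := repunit_split hij
  have := repunit_nonneg i
  have := two_mul_repunit i
  obtain ⟨c, rfl⟩ := Nat.exists_eq_add_of_lt hij
  exact not_inU (a := 3 * 3 ^ c + a) (r := repunit i + u) (a' := m * 3 ^ c) (d := 1) (r' := 0) i
    (by rw [ha]; ring) (by omega) (by omega) (by ring) le_rfl (by norm_num) le_rfl (by positivity)

/-- Here `repunit i + (repunit i + 1) = 3 ^ i` carries into digit `i`, which becomes `1` while that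
of `y` is `1` or `2`. This hole stops the high growth replayed at scale `i`. -/
theorem not_middle (h0 : 3 ^ i ≤ y) (h1 : y < 3 ^ (i + 1)) :
    ¬ LobeMem i (repunit i + 1) y := by
  have := repunit_nonneg i
  have := two_mul_repunit i
  have hx : 3 ^ (i + 1) + repunit i + (repunit i + 1) = 1 * 3 ^ (i + 1) + 3 ^ i + (0 : ℤ) := by
    linarith
  rw [pow_succ] at h1
  rcases lt_or_ge y (2 * 3 ^ i) with h | h
  · exact not_inU (a' := 0) (d := 1) (r' := y - 3 ^ i) i hx le_rfl (by positivity) (by ring)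
      le_rfl (by norm_num) (by omega) (by omega)
  · exact not_inU (a' := 0) (d := 2) (r' := y - 2 * 3 ^ i) i hx le_rfl (by positivity) (by ring)
      (by norm_num) (by norm_num) (by omega) (by omega)

theorem le_repunit (h : LobeMem j u (3 ^ j)) (h1 : u < 3 ^ j) : u ≤ repunit j := by
  by_contra! h0
  have := repunit_nonneg j
  have := two_mul_repunit j
  exact not_inU (a := 1) (r := repunit j + u - 3 ^ j) (a' := 0) (d := 1) (r' := 0) j
    (by ring) (by omega) (by omega) (by ring) le_rfl (by norm_num) le_rfl (by positivity) h

theorem corner (j : ℕ) : LobeMem j (repunit j) (3 ^ j) := by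
  have h0 := repunit_nonneg j
  have h2 := two_mul_repunit j
  have hp : (0 : ℤ) < 3 ^ j := by positivity
  refine ⟨by positivity, by positivity, fun k hk => ?_⟩
  rcases lt_trichotomy k j with h | rfl | h
  · obtain ⟨c, rfl⟩ := Nat.exists_eq_add_of_lt h
    exact digit_eq (a := 3 ^ c) (d := 0) (r := 0) (by ring) le_rfl (by norm_num) le_rfl
      (by positivity)
  · rw [digit_eq (a := 1) (d := 0) (r := 3 ^ k - 1) (by linarith) le_rfl (by norm_num)
      (by omega) (by omega)] at hk
    omega
  · have := pow_three_lt h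
    rw [Int.ediv_eq_zero_of_lt hp.le (by omega)]; rfl

end LobeMem

/-! ### Assembly sequences -/

namespace Assembly

variable {L : Type*} {S : Finset (TileType L)} (strength : L → ℕ)

theorem bond_le_bond {a b : Assembly S} {p q : ℤ × ℤ} {d : Side} (h : a p = b q)
    (hd : a (p + d.vec) ≠ none → b (q + d.vec) = a (p + d.vec)) :
    a.bond strength p d ≤ b.bond strength q d := by
  by_cases h0 : a (p + d.vec) = none
  · have : a.bond strength p d = 0 := by
      unfold bond; rw [h0]; cases a p <;> rfl
    omega
  · unfold bond
    rw [h, hd h0]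

theorem bondSum_le_bondSum {a b : Assembly S} {p q : ℤ × ℤ} (h : a p = b q)
    (hd : ∀ d : Side, a (p + d.vec) ≠ none → b (q + d.vec) = a (p + d.vec)) :
    a.bondSum strength p ≤ b.bondSum strength q := by
  unfold bondSum
  gcongr <;> exact bond_le_bond strength h (hd _)

theorem exists_neighbor {a : Assembly S} {p : ℤ × ℤ} (h : a.bondSum strength p ≠ 0) :
    ∃ d : Side, a (p + d.vec) ≠ none := by
  by_contra! h0
  have : ∀ d, a.bond strength p d = 0 := by
    intro d
    unfold bond; rw [h0]; cases a p <;> rfl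
  simp [bondSum, this] at h

theorem mem_dom {T : Type*} {a : Assembly T} {p : ℤ × ℤ} : p ∈ a.dom ↔ a p ≠ none :=
  Option.isSome_iff_ne_none

end Assembly

theorem Side.vec_ne_zero (d : Side) : d.vec ≠ 0 := by
  cases d <;> simp [Side.vec]

theorem Side.vec_cases (d : Side) : (d.vec.1 = 0 ∧ (d.vec.2 = 1 ∨ d.vec.2 = -1)) ∨
    (d.vec.2 = 0 ∧ (d.vec.1 = 1 ∨ d.vec.1 = -1)) := by
  cases d <;> simp [Side.vec]

namespace TAS

variable {L : Type*} {𝒯 : TAS L}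

theorem Step.dom_finite {a b : Assembly 𝒯.tiles} (h : 𝒯.Step a b) (ha : a.dom.Finite) :
    b.dom.Finite := by
  obtain ⟨p, t, -, rfl, -⟩ := h
  refine (ha.insert p).subset fun q hq => ?_
  by_cases hqp : q = p
  · exact Or.inl hqp
  · right
    rw [Assembly.mem_dom] at hq ⊢
    rwa [Function.update_of_ne hqp] at hq

theorem dom_finite_of_reflTransGen {a b : Assembly 𝒯.tiles}
    (h : Relation.ReflTransGen 𝒯.Step a b) (ha : a.dom.Finite) : b.dom.Finite := by
  induction h with
  | refl => exact ha
  | tail _ h ih => exact h.dom_finite ih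

theorem Producible.dom_finite {a : Assembly 𝒯.tiles} (h : 𝒯.Producible a) : a.dom.Finite :=
  dom_finite_of_reflTransGen h 𝒯.seed_stable.1

theorem Step.le {a b : Assembly 𝒯.tiles} (h : 𝒯.Step a b) {p : ℤ × ℤ} (hp : a p ≠ none) :
    b p = a p := by
  obtain ⟨q, t, hq, rfl, -⟩ := h
  refine Function.update_of_ne ?_ _ _
  rintro rfl
  exact hp hq

theorem GrowsInto.dom_subset {a b : Assembly 𝒯.tiles} (h : 𝒯.GrowsInto a b) : a.dom ⊆ b.dom := by
  intro p hp
  rcases h with h | ⟨f, rfl, -, hb⟩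
  · induction h with
    | refl => exact hp
    | tail _ h ih =>
      rw [Assembly.mem_dom] at ih ⊢
      rwa [h.le ih]
  · obtain ⟨t, ht⟩ := Option.isSome_iff_exists.1 hp
    exact Option.isSome_iff_exists.2 ⟨t, (hb p t).2 ⟨0, ht⟩⟩

theorem FinitelySelfAssembles.dom_subset {X : Set (ℤ × ℤ)} (h : 𝒯.FinitelySelfAssembles X)
    {a : Assembly 𝒯.tiles} (ha : 𝒯.Producible a) : a.dom ⊆ X := by
  obtain ⟨b, hb, rfl⟩ := h a ha ha.dom_finite
  exact hb.dom_subset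

/-- An infinite assembly sequence, with the points and the tiles of its attachments. -/
structure Growth (𝒯 : TAS L) where
  asm : ℕ → Assembly 𝒯.tiles
  pos : ℕ → ℤ × ℤ
  tile : ℕ → 𝒯.tiles
  zero : asm 0 = 𝒯.seed
  pos_none : ∀ n, asm n (pos n) = none
  succ : ∀ n, asm (n + 1) = Function.update (asm n) (pos n) (some (tile n))
  temp_le : ∀ n, 𝒯.temp ≤ (asm (n + 1)).bondSum 𝒯.strength (pos n)

theorem FinitelySelfAssembles.exists_growth {X : Set (ℤ × ℤ)} (h : 𝒯.FinitelySelfAssembles X)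
    (hX : X.Infinite) : ∃ f : Growth 𝒯, ∀ p ∈ X, ∃ n, f.asm n p ≠ none := by
  obtain ⟨b, hb, rfl⟩ := h 𝒯.seed .refl 𝒯.seed_stable.1
  rcases hb with hb | ⟨f, h0, hs, hb⟩
  · exact absurd (Producible.dom_finite hb) hX
  · choose p t h1 h2 h3 using hs
    refine ⟨⟨f, p, t, h0, h1, h2, h3⟩, fun q hq => ?_⟩
    obtain ⟨s, hs⟩ := Option.isSome_iff_exists.1 hq
    obtain ⟨n, hn⟩ := (hb q s).1 hs
    exact ⟨n, by simp [hn]⟩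

/-- At temperature `0` any tile could be attached at `p`, outside the shape. -/
theorem FinitelySelfAssembles.temp_pos {X : Set (ℤ × ℤ)} (h : 𝒯.FinitelySelfAssembles X)
    (hX : X.Infinite) {p : ℤ × ℤ} (hp : p ∉ X) : 0 < 𝒯.temp := by
  by_contra! h0
  obtain ⟨f, -⟩ := h.exists_growth hX
  have hn : 𝒯.seed p = none := by
    by_contra hs
    exact hp (h.dom_subset .refl (Assembly.mem_dom.2 hs))
  have : 𝒯.Producible (Function.update 𝒯.seed p (some (f.tile 0))) :=
    .single ⟨p, f.tile 0, hn, rfl, by omega⟩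
  exact hp (h.dom_subset this (by simp [Assembly.dom]))

namespace Growth

variable (f : Growth 𝒯)

theorem step_succ (n : ℕ) : 𝒯.Step (f.asm n) (f.asm (n + 1)) :=
  ⟨f.pos n, f.tile n, f.pos_none n, f.succ n, f.temp_le n⟩

theorem producible (n : ℕ) : 𝒯.Producible (f.asm n) := by
  induction n with
  | zero => rw [f.zero]; exact .refl
  | succ n ih => exact ih.tail (f.step_succ n)

theorem asm_mono {m n : ℕ} (h : m ≤ n) {p : ℤ × ℤ} (hp : f.asm m p ≠ none) :
    f.asm n p = f.asm m p := by
  induction n, h using Nat.le_induction with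
  | base => rfl
  | succ n _ ih => rw [(f.step_succ n).le (by rwa [ih]), ih]

theorem ne_none_mono {m n : ℕ} (h : m ≤ n) {p : ℤ × ℤ} (hp : f.asm m p ≠ none) :
    f.asm n p ≠ none := by
  rwa [f.asm_mono h hp]

theorem pos_ne_none (n : ℕ) : f.asm (n + 1) (f.pos n) ≠ none := by
  simp [f.succ]

theorem asm_succ_of_ne {n : ℕ} {p : ℤ × ℤ} (h : p ≠ f.pos n) : f.asm (n + 1) p = f.asm n p := by
  rw [f.succ, Function.update_of_ne h]

theorem exists_pos_eq {n : ℕ} {p : ℤ × ℤ} (h0 : 𝒯.seed p = none) (hn : f.asm n p ≠ none) :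
    ∃ m < n, f.pos m = p := by
  induction n with
  | zero => exact absurd (by rw [f.zero, h0]) hn
  | succ n ih =>
    by_cases h : p = f.pos n
    · exact ⟨n, by omega, h.symm⟩
    · rw [f.asm_succ_of_ne h] at hn
      obtain ⟨m, hm, e⟩ := ih hn
      exact ⟨m, by omega, e⟩

theorem exists_neighbor (ht : 0 < 𝒯.temp) (n : ℕ) :
    ∃ d : Side, f.asm n (f.pos n + d.vec) ≠ none := by
  obtain ⟨d, hd⟩ := Assembly.exists_neighbor 𝒯.strength (ht.trans_le (f.temp_le n)).ne'
  refine ⟨d, ?_⟩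
  rwa [f.asm_succ_of_ne (by simpa using d.vec_ne_zero)] at hd

/-- The `n`-th attachment can be performed in every assembly that contains a translate of
its neighbours. -/
theorem step_update (n : ℕ) (v : ℤ × ℤ) {a : Assembly 𝒯.tiles} (ha : a (f.pos n + v) = none)
    (h : ∀ d : Side, f.asm n (f.pos n + d.vec) ≠ none →
      a (f.pos n + d.vec + v) = f.asm n (f.pos n + d.vec)) :
    𝒯.Step a (Function.update a (f.pos n + v) (some (f.tile n))) := by
  refine ⟨_, _, ha, rfl, (f.temp_le n).trans ?_⟩
  refine Assembly.bondSum_le_bondSum _ (by simp [f.succ]) fun d hd => ?_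
  have hne := d.vec_ne_zero
  rw [f.asm_succ_of_ne (by simpa using hne)] at hd ⊢
  rw [← h d hd, Function.update_of_ne (by simpa using hne), add_right_comm]

open Classical in
/-- Removing a set of tiles on which no other attachment depends leaves a producible assembly. -/
theorem producible_restrict (C : Set (ℤ × ℤ)) (hseed : ∀ p ∈ C, 𝒯.seed p = none) (n : ℕ)
    (h : ∀ m < n, f.pos m ∉ C → ∀ d : Side, f.pos m + d.vec ∈ C →
      f.asm m (f.pos m + d.vec) = none) :
    𝒯.Producible fun p => if p ∈ C then none else f.asm n p := by
  induction n with
  | zero =>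
    convert (show 𝒯.Producible 𝒯.seed from .refl) using 1
    funext p
    split_ifs with hp
    · exact (hseed p hp).symm
    · rw [f.zero]
  | succ n ih =>
    specialize ih fun m hm => h m (by omega)
    by_cases hp : f.pos n ∈ C
    · convert ih using 1
      funext q
      split_ifs with hq
      · rfl
      · exact f.asm_succ_of_ne fun e => hq (e ▸ hp)
    · have := f.step_update n 0 (a := fun p => if p ∈ C then none else f.asm n p)
        (by simp [hp, f.pos_none]) fun d hd => by
          simp only [add_zero]
          exact if_neg fun hC => hd (h n (by omega) hp d hC)
      refine ih.tail ?_
      convert this using 1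
      funext q
      by_cases hq : q = f.pos n
      · subst hq; simp [hp, f.succ]
      · simp [f.asm_succ_of_ne hq, Function.update_of_ne hq]

open Classical in
/-- If the attachments in `C` depend only on `C` and on the tile at `b`, then they can be
repeated at the translate of `C` in every producible assembly that has the same tile at the
translate of `b` and is empty on the translate of `C`. -/
theorem producible_merge (C : Set (ℤ × ℤ)) (b v : ℤ × ℤ) (hb : b ∉ C) {a : Assembly 𝒯.tiles}
    (ha : 𝒯.Producible a) (haC : ∀ p ∈ C, a (p + v) = none)
    (hseed : ∀ p ∈ C, 𝒯.seed p = none) (n : ℕ)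
    (hab : ∀ m ≤ n, f.asm m b ≠ none → a (b + v) = f.asm m b)
    (h : ∀ m < n, f.pos m ∈ C → ∀ d : Side, f.asm m (f.pos m + d.vec) ≠ none →
      f.pos m + d.vec ∈ C ∨ f.pos m + d.vec = b) :
    𝒯.Producible fun q => if q - v ∈ C then f.asm n (q - v) else a q := by
  induction n with
  | zero =>
    convert ha using 1
    funext q
    split_ifs with hq
    · have := haC _ hq
      rw [sub_add_cancel] at this
      rw [f.zero, hseed _ hq, this]
    · rfl
  | succ n ih =>
    specialize ih (fun m hm => hab m (by omega)) fun m hm => h m (by omega)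
    by_cases hp : f.pos n ∈ C
    · have := f.step_update n v (a := fun q => if q - v ∈ C then f.asm n (q - v) else a q)
        (by simp [hp, f.pos_none]) fun d hd => by
          simp only [add_sub_cancel_right]
          rcases h n (by omega) hp d hd with hC | hC
          · rw [if_pos hC]
          · rw [hC] at hd ⊢
            rw [if_neg hb, hab n (by omega) hd]
      refine ih.tail ?_
      convert this using 1
      funext q
      by_cases hq : q = f.pos n + v
      · subst hq; simp [hp, f.succ]
      · rw [Function.update_of_ne hq, f.asm_succ_of_ne fun e => hq (sub_eq_iff_eq_add.1 e)]
    · convert ih using 1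
      funext q
      split_ifs with hq
      · exact f.asm_succ_of_ne fun e => hp (e ▸ hq)
      · rfl

end Growth

end TAS

/-! ### Attachments in a lobe -/

/-- The point with lobe coordinates `(u, y)` in the left (`ε = 1`) or right (`ε = -1`) inner lobe
of scale `j`. Both lobes meet at the cut point `u = 3 ^ j`, `y = 0`. -/
def lobePoint (ε : ℤ) (j : ℕ) (u y : ℤ) : ℤ × ℤ :=
  (3 ^ (j + 1) + repunit (j + 1) + ε * (u - 3 ^ j), y)

/-- Two points with coordinates `(u, y)` and `(u', y')` are adjacent. -/
def Near (u y u' y' : ℤ) : Prop :=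
  (u' = u ∧ (y' = y + 1 ∨ y' = y - 1)) ∨ (y' = y ∧ (u' = u + 1 ∨ u' = u - 1))

theorem lobePoint_mem {ε : ℤ} (hε : ε = 1 ∨ ε = -1) {j : ℕ} {u y : ℤ} (h0 : 0 ≤ u)
    (h1 : u ≤ 3 ^ j) : lobePoint ε j u y ∈ DSSF.uFractal ↔ LobeMem j u y := by
  have hp : (0 : ℤ) < 3 ^ j := by positivity
  have hr := repunit_nonneg j
  have h2 := two_mul_repunit j
  rw [DSSF.mem_uFractal, LobeMem, lobePoint]
  rcases hε with rfl | rfl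
  · simp only [repunit]
    ring_nf
  · simp only [repunit]
    have e1 : (3 : ℤ) ^ (j + 1) + (3 ^ j + repunit j) + -1 * (u - 3 ^ j) =
        3 ^ (j + 1) + (3 ^ (j + 1) - 1 - (repunit j + u)) := by
      rw [pow_succ]; linarith
    have e2 : (3 : ℤ) ^ (j + 1) + repunit j + u = 3 ^ (j + 1) + (3 ^ (j + 1) - 1 -
        (3 ^ (j + 1) - 1 - (repunit j + u))) := by ring
    have := pow_succ (3 : ℤ) j
    constructor
    · intro h
      rw [e2]
      rw [e1] at h
      exact h.mirror (by omega) (by omega)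
    · intro h
      rw [add_assoc] at h
      rw [e1]
      exact h.mirror (by omega) (by omega)

theorem lobePoint_inj {ε : ℤ} (hε : ε = 1 ∨ ε = -1) {j : ℕ} {u y u' y' : ℤ} :
    lobePoint ε j u y = lobePoint ε j u' y' ↔ u = u' ∧ y = y' := by
  simp only [lobePoint, Prod.mk.injEq]
  rcases hε with rfl | rfl <;> omega

theorem exists_lobePoint {ε : ℤ} (hε : ε = 1 ∨ ε = -1) (j : ℕ) (p : ℤ × ℤ) :
    ∃ u y, p = lobePoint ε j u y := by
  refine ⟨ε * (p.1 - 3 ^ (j + 1) - repunit (j + 1)) + 3 ^ j, p.2, ?_⟩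
  rcases hε with rfl | rfl <;> ext <;> simp [lobePoint]

theorem near_of_add_vec {ε : ℤ} (hε : ε = 1 ∨ ε = -1) {j : ℕ} {u y u' y' : ℤ} {d : Side}
    (h : lobePoint ε j u y + d.vec = lobePoint ε j u' y') : Near u y u' y' := by
  have h1 := congrArg Prod.fst h
  have h2 := congrArg Prod.snd h
  simp only [lobePoint, Prod.fst_add, Prod.snd_add] at h1 h2
  have := d.vec_cases
  unfold Near
  rcases hε with rfl | rfl <;> omega

/-- The part of a lobe that may be reached from its lowest cut point. -/
def LowZone (j : ℕ) (u y : ℤ) : Prop := 0 ≤ u ∧ u < 3 ^ j ∧ 0 ≤ y ∧ y < 3 ^ j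

/-- A small box at the cut point at height `m * 3 ^ j` of a lobe of scale `j`. -/
def HighZone (i j : ℕ) (m u y : ℤ) : Prop :=
  0 ≤ u ∧ u ≤ repunit i ∧ m * 3 ^ j ≤ y ∧ y < m * 3 ^ j + 3 ^ i

/-- The box is closed below by `not_below` and above by `not_above`, so it can be left only through
the column `repunit i + 1`. -/
theorem HighZone.near {i j : ℕ} (hij : i + 2 ≤ j) {m u y u' y' : ℤ} (h : HighZone i j m u' y')
    (hn : Near u y u' y') (hu : 0 ≤ u) (hU : LobeMem j u y) :
    u ≤ repunit i + 1 ∧ m * 3 ^ j ≤ y ∧ y < m * 3 ^ j + 3 ^ i := by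
  obtain ⟨h0, h1, h2, h3⟩ := h
  have h4 : u ≤ repunit i + 1 := by unfold Near at hn; omega
  have hb : y ≠ m * 3 ^ j - 1 := by
    rintro rfl; exact LobeMem.not_below hij hu h4 hU
  have ht : u ≤ repunit i → y ≠ m * 3 ^ j + 3 ^ i := by
    rintro h rfl; exact LobeMem.not_above (by omega) hu h hU
  unfold Near at hn
  omega

theorem LowZone.not_near {i j : ℕ} (hij : i + 2 ≤ j) {m u y u' y' : ℤ} (hm : 1 ≤ m)
    (h : LowZone j u' y') (hU' : LobeMem j u' y') (hn : Near u y u' y') (h0 : 0 ≤ u)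
    (h1 : u ≤ repunit i + 1) (h2 : m * 3 ^ j ≤ y) : False := by
  obtain ⟨h3, h4, h5, h6⟩ := h
  have hp : (0 : ℤ) < 3 ^ j := by positivity
  have : 3 ^ j ≤ m * 3 ^ j := by nlinarith
  have e : y' = 1 * 3 ^ j - 1 := by unfold Near at hn; omega
  have e' : u' = u := by unfold Near at hn; omega
  subst e e'
  exact LobeMem.not_below hij h0 h1 hU'

/-! ### Confinement of the growth in a lobe -/

namespace TAS

variable {L : Type*} {𝒯 : TAS L}

/-- The tiles that can occur at the cut point at height `m * 3 ^ j` of the lobe of scale `j` in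
a producible assembly that is empty in the lobe above height `l * 3 ^ j`. -/
def cutTiles (𝒯 : TAS L) (ε : ℤ) (m l : ℤ) (j : ℕ) : Set 𝒯.tiles :=
  {t | ∃ a, 𝒯.Producible a ∧ a (lobePoint ε j 0 (m * 3 ^ j)) = some t ∧
    ∀ u y, 0 < u → u < 3 ^ j → l * 3 ^ j ≤ y → y < 3 ^ (j + 1) → a (lobePoint ε j u y) = none}

namespace Growth

/-- The growth `f` enters the lobe of scale `j` with the side `ε` only at the cut points with
`u = 0`. -/
structure LobeGrowth (f : Growth 𝒯) (ε : ℤ) (i j : ℕ) : Prop where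
  sign : ε = 1 ∨ ε = -1
  pos : 1 ≤ i
  lt : i + 2 ≤ j
  temp : 0 < 𝒯.temp
  dom : 𝒯.FinitelySelfAssembles DSSF.uFractal
  seed : ∀ u y, 0 ≤ u → u ≤ 3 ^ j → 0 ≤ y → 𝒯.seed (lobePoint ε j u y) = none
  side : ∃ n, f.pos n = lobePoint ε j (3 ^ j) 0 ∧ f.asm n (lobePoint ε j (3 ^ j - 1) 0) ≠ none

/-- All tiles in the lobe after `n` attachments are in the zones of cut points that carry
a tile. -/
def Confined (f : Growth 𝒯) (ε : ℤ) (i j n : ℕ) : Prop :=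
  ∀ u y, 0 < u → u < 3 ^ j → 0 ≤ y → y < 3 ^ (j + 1) → f.asm n (lobePoint ε j u y) ≠ none →
    (LowZone j u y ∧ f.asm n (lobePoint ε j 0 0) ≠ none) ∨
    ∃ m, (m = 1 ∨ m = 2) ∧ HighZone i j m u y ∧ f.asm n (lobePoint ε j 0 (m * 3 ^ j)) ≠ none

theorem mem_of_ne_none (f : Growth 𝒯) {X : Set (ℤ × ℤ)} (h : 𝒯.FinitelySelfAssembles X) {n : ℕ}
    {p : ℤ × ℤ} (hp : f.asm n p ≠ none) : p ∈ X :=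
  h.dom_subset (f.producible n) (Assembly.mem_dom.2 hp)

namespace LobeGrowth

variable {f : Growth 𝒯} {ε : ℤ} {i j : ℕ}

theorem lobeMem (h : LobeGrowth f ε i j) {n : ℕ} {u y : ℤ} (h0 : 0 ≤ u) (h1 : u ≤ 3 ^ j)
    (hp : f.asm n (lobePoint ε j u y) ≠ none) : LobeMem j u y :=
  (lobePoint_mem h.sign h0 h1).1 (f.mem_of_ne_none h.dom hp)

theorem lobeMem_pos (h : LobeGrowth f ε i j) {n : ℕ} {u y : ℤ} (h0 : 0 ≤ u) (h1 : u ≤ 3 ^ j)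
    (hp : f.pos n = lobePoint ε j u y) : LobeMem j u y :=
  h.lobeMem h0 h1 (n := n + 1) (hp ▸ f.pos_ne_none n)

theorem bounds (h : LobeGrowth f ε i j) : 0 ≤ repunit i ∧ 3 * repunit i + 3 ≤ (3 : ℤ) ^ j ∧
    3 * 3 ^ i ≤ (3 : ℤ) ^ j ∧ 0 < (3 : ℤ) ^ i ∧ (3 : ℤ) ^ (j + 1) = 3 * 3 ^ j ∧
    2 * repunit i + 1 = 3 ^ i := by
  have h0 := repunit_nonneg i
  have h1 := two_mul_repunit i
  have h2 := pow_three_lt (show i < j from by have := h.lt; omega)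
  have h3 : (0 : ℤ) < 3 ^ i := by positivity
  refine ⟨h0, ?_, h2, h3, by rw [pow_succ, mul_comm], h1⟩
  omega

/-- Every tile next to an attachment in the lobe is in the zone of a cut point that carries
a tile. -/
theorem neighbor_zone (h : LobeGrowth f ε i j) {n : ℕ} (hc : f.Confined ε i j n) {u y : ℤ}
    (hp : f.pos n = lobePoint ε j u y) (h0 : 0 < u) (h1 : u < 3 ^ j) (h2 : 0 ≤ y)
    (h3 : y < 3 ^ (j + 1)) {d : Side} (hd : f.asm n (f.pos n + d.vec) ≠ none) :
    ∃ u' y', f.pos n + d.vec = lobePoint ε j u' y' ∧ Near u y u' y' ∧ LobeMem j u' y' ∧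
      ((LowZone j u' y' ∧ f.asm n (lobePoint ε j 0 0) ≠ none ∧ (u' = 0 → y' = 0)) ∨
      ∃ m, (m = 1 ∨ m = 2) ∧ HighZone i j m u' y' ∧
        f.asm n (lobePoint ε j 0 (m * 3 ^ j)) ≠ none ∧ (u' = 0 → y' = m * 3 ^ j)) := by
  obtain ⟨u', y', e⟩ := exists_lobePoint h.sign j (f.pos n + d.vec)
  have hn : Near u y u' y' := near_of_add_vec h.sign (hp ▸ e)
  rw [e] at hd
  have b0 : 0 ≤ u' := by unfold Near at hn; omega
  have b1 : u' ≤ 3 ^ j := by unfold Near at hn; omega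
  have hU := h.lobeMem b0 b1 hd
  refine ⟨u', y', e, hn, hU, ?_⟩
  have b2 := hU.nonneg
  have b3 : y' < 3 ^ (j + 1) := by
    have : y' ≠ 3 ^ (j + 1) := by rintro rfl; exact LobeMem.not_top b0 b1 hU
    unfold Near at hn; omega
  obtain ⟨g0, g1, g2, g3, g4, g5⟩ := h.bounds
  have gj : (0 : ℤ) < 3 ^ j := by positivity
  rcases b0.eq_or_lt with rfl | b0'
  · rcases hU.eq_mul_of_zero b3 with rfl | rfl | rfl
    · exact Or.inl ⟨⟨by omega, by omega, by omega, by omega⟩, hd, fun _ => rfl⟩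
    · exact Or.inr ⟨1, by simp, ⟨by omega, by omega, by omega, by omega⟩, by simpa using hd,
        by simp⟩
    · exact Or.inr ⟨2, by simp, ⟨by omega, by omega, by omega, by omega⟩, hd, by simp⟩
  rcases b1.eq_or_lt with rfl | b1'
  · have := hU.eq_zero_of_right b3
    subst this
    have : u = 3 ^ j - 1 ∧ y = 0 := by unfold Near at hn; omega
    obtain ⟨rfl, rfl⟩ := this
    -- The attachment would be at the only lobe neighbour of the shared gate, after the gate was
    -- filled; but that neighbour was filled before the gate.
    obtain ⟨k, hk, hk'⟩ := h.side
    have hkn : k ≤ n := by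
      by_contra! hkn
      have := f.ne_none_mono hkn.le hd
      rw [← hk, f.pos_none] at this
      exact this rfl
    have := f.ne_none_mono hkn hk'
    rw [← hp, f.pos_none] at this
    exact absurd rfl this
  · rcases hc u' y' b0' b1' b2 b3 hd with ⟨hz, hb⟩ | ⟨m, hm, hz, hb⟩
    · exact Or.inl ⟨hz, hb, by omega⟩
    · exact Or.inr ⟨m, hm, hz, hb, by omega⟩

/-- An attachment next to a nonempty high zone is inside the lobe, close to that zone. -/
theorem near_highZone (h : LobeGrowth f ε i j) {n : ℕ} {m u y u' y' : ℤ} (hm : m = 1 ∨ m = 2)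
    (hz : HighZone i j m u' y') (hu' : 0 < u')
    (hb : f.asm n (lobePoint ε j 0 (m * 3 ^ j)) ≠ none)
    (hp : f.pos n = lobePoint ε j u y) (hn : Near u y u' y') :
    0 < u ∧ u ≤ repunit i + 1 ∧ m * 3 ^ j ≤ y ∧ y < m * 3 ^ j + 3 ^ i := by
  obtain ⟨g0, g1, g2, g3, g4, g5⟩ := h.bounds
  obtain ⟨z0, z1, z2, z3⟩ := hz
  have b0 : 0 ≤ u := by unfold Near at hn; omega
  have b1 : u ≤ 3 ^ j := by unfold Near at hn; omega
  have hU := h.lobeMem_pos b0 b1 hp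
  refine ⟨?_, HighZone.near h.lt ⟨z0, z1, z2, z3⟩ hn b0 hU⟩
  refine b0.lt_of_ne ?_
  rintro rfl
  have b3 : y < 3 ^ (j + 1) := by
    unfold Near at hn; rcases hm with rfl | rfl <;> omega
  have : y = m * 3 ^ j := by
    unfold Near at hn
    rcases hm with rfl | rfl <;> rcases hU.eq_mul_of_zero b3 with h | h | h <;> omega
  rw [← this, ← hp, f.pos_none] at hb
  exact hb rfl

/-- Confined tiles above `3 ^ j` lie in the boxes, and any later attachment next to them is again in
that part of the lobe. Erasing it therefore costs nothing outside it. -/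
theorem mem_cutTiles_high (h : LobeGrowth f ε i j) {n : ℕ} (hc : ∀ k ≤ n, f.Confined ε i j k)
    {m : ℤ} {t : 𝒯.tiles} (ht : f.asm n (lobePoint ε j 0 (m * 3 ^ j)) = some t) :
    t ∈ 𝒯.cutTiles ε m 1 j := by
  classical
  obtain ⟨g0, g1, g2, g3, g4, g5⟩ := h.bounds
  have gj : (0 : ℤ) < 3 ^ j := by positivity
  set C : Set (ℤ × ℤ) := {p | ∃ u y, p = lobePoint ε j u y ∧ 0 < u ∧ u < 3 ^ j ∧
    1 * 3 ^ j ≤ y ∧ y < 3 ^ (j + 1)} with hC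
  refine ⟨_, f.producible_restrict C ?_ n ?_, ?_, ?_⟩
  · rintro _ ⟨u, y, rfl, b0, b1, b2, b3⟩
    exact h.seed _ _ (by omega) (by omega) (by omega)
  · rintro k hk hpC d ⟨u', y', e, b0, b1, b2, b3⟩
    by_contra hd
    obtain ⟨u, y, hp⟩ := exists_lobePoint h.sign j (f.pos k)
    have hn : Near u y u' y' := near_of_add_vec h.sign (hp ▸ e)
    rw [e] at hd
    rcases hc k hk.le u' y' b0 b1 (by omega) b3 hd with ⟨hz, -⟩ | ⟨m, hm, hz, hb⟩
    · have := hz.2.2.2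
      omega
    · obtain ⟨c0, c1, c2, c3⟩ := h.near_highZone hm hz b0 hb hp hn
      refine hpC ⟨u, y, hp, c0, by omega, ?_, ?_⟩ <;> rcases hm with rfl | rfl <;> omega
  · rw [if_neg, ht]
    rintro ⟨u, y, e, b0, -⟩
    rw [lobePoint_inj h.sign] at e
    omega
  · intro u y b0 b1 b2 b3
    exact if_pos ⟨u, y, rfl, b0, b1, b2, b3⟩

/-- The sequence is stopped just after the lowest cut tile is attached. The low zone is still empty
then, so only the boxes have to be erased and the whole lobe becomes empty. -/
theorem mem_cutTiles_low (h : LobeGrowth f ε i j) {n : ℕ} (hc : ∀ k ≤ n, f.Confined ε i j k)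
    {t : 𝒯.tiles} (ht : f.asm n (lobePoint ε j 0 (0 * 3 ^ j)) = some t) :
    t ∈ 𝒯.cutTiles ε 0 0 j := by
  classical
  obtain ⟨g0, g1, g2, g3, g4, g5⟩ := h.bounds
  have gj : (0 : ℤ) < 3 ^ j := by positivity
  obtain ⟨l, hln, hl⟩ := f.exists_pos_eq (h.seed 0 (0 * 3 ^ j) le_rfl gj.le (by omega))
    (by rw [ht]; simp)
  set C : Set (ℤ × ℤ) := {p | ∃ u y, p = lobePoint ε j u y ∧ 0 < u ∧ u < 3 ^ j ∧
    0 * 3 ^ j ≤ y ∧ y < 3 ^ (j + 1)} with hC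
  refine ⟨_, f.producible_restrict C ?_ (l + 1) ?_, ?_, ?_⟩
  · rintro _ ⟨u, y, rfl, b0, b1, b2, b3⟩
    exact h.seed _ _ (by omega) (by omega) (by omega)
  · rintro k hk hpC d ⟨u', y', e, b0, b1, b2, b3⟩
    by_contra hd
    obtain ⟨u, y, hp⟩ := exists_lobePoint h.sign j (f.pos k)
    have hn : Near u y u' y' := near_of_add_vec h.sign (hp ▸ e)
    rw [e] at hd
    rcases hc k (by omega) u' y' b0 b1 (by omega) b3 hd with ⟨-, hb⟩ | ⟨m, hm, hz, hb⟩
    · have := f.ne_none_mono (show k ≤ l by omega) hb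
      rw [zero_mul] at hl
      rw [← hl, f.pos_none] at this
      exact this rfl
    · obtain ⟨c0, c1, c2, c3⟩ := h.near_highZone hm hz b0 hb hp hn
      refine hpC ⟨u, y, hp, c0, by omega, ?_, ?_⟩ <;> rcases hm with rfl | rfl <;> omega
  · rw [if_neg]
    · rw [← ht]
      exact (f.asm_mono hln (hl ▸ f.pos_ne_none l)).symm
    rintro ⟨u, y, e, b0, -⟩
    rw [lobePoint_inj h.sign] at e
    omega
  · intro u y b0 b1 b2 b3
    exact if_pos ⟨u, y, rfl, b0, b1, b2, b3⟩

/-- A growth in a zone `Z` of the lobe that depends only on one cut point, and whose next attachment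
would leave the fractal at the same cut point of another scale, is impossible. -/
theorem not_leave (h : LobeGrowth f ε i j) {n k : ℕ} {m l : ℤ} {t : 𝒯.tiles}
    (ht : f.asm n (lobePoint ε j 0 (m * 3 ^ j)) = some t) (htk : t ∈ 𝒯.cutTiles ε m l k)
    (Z : ℤ → ℤ → Prop) {u y : ℤ} (hp : f.pos n = lobePoint ε j u y)
    (hu0 : 0 < u) (huj : u ≤ 3 ^ j) (huk : u ≤ 3 ^ k)
    (hy : ¬ LobeMem k u (y - m * 3 ^ j + m * 3 ^ k))
    (hZ : ∀ u y, Z u y → 0 < u ∧ u < 3 ^ k ∧ u < 3 ^ j ∧ 0 ≤ y ∧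
      l * 3 ^ k ≤ y - m * 3 ^ j + m * 3 ^ k ∧ y - m * 3 ^ j + m * 3 ^ k < 3 ^ (k + 1))
    (hdep : ∀ k ≤ n, ∀ u₀ y₀, f.pos k = lobePoint ε j u₀ y₀ → Z u₀ y₀ ∨ (u₀ = u ∧ y₀ = y) →
      ∀ d : Side, f.asm k (f.pos k + d.vec) ≠ none →
      (∃ u' y', f.pos k + d.vec = lobePoint ε j u' y' ∧ Z u' y') ∨
        f.pos k + d.vec = lobePoint ε j 0 (m * 3 ^ j)) : False := by
  classical
  obtain ⟨a, ha, hat, hae⟩ := htk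
  have hU := h.lobeMem_pos hu0.le huj hp
  set C : Set (ℤ × ℤ) := {p | ∃ u₀ y₀, p = lobePoint ε j u₀ y₀ ∧
    (Z u₀ y₀ ∨ (u₀ = u ∧ y₀ = y))} with hC
  -- The translation carries the cut point of scale `j` to the cut point of scale `k` with the same
  -- index `m`.
  set v : ℤ × ℤ := lobePoint ε k 0 (m * 3 ^ k) - lobePoint ε j 0 (m * 3 ^ j) with hv
  have hshift : ∀ u y, lobePoint ε j u y + v = lobePoint ε k u (y - m * 3 ^ j + m * 3 ^ k) := by
    intro u y
    ext <;>
      simp only [hv, lobePoint, Prod.fst_add, Prod.fst_sub, Prod.snd_add, Prod.snd_sub] <;> ring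
  have hout : lobePoint ε k u (y - m * 3 ^ j + m * 3 ^ k) ∉ DSSF.uFractal := by
    rwa [lobePoint_mem h.sign hu0.le huk]
  have hbC : lobePoint ε j 0 (m * 3 ^ j) ∉ C := by
    rintro ⟨u₀, y₀, e, hz⟩
    rw [lobePoint_inj h.sign] at e
    rcases hz with hz | hz
    · have := (hZ _ _ hz).1
      omega
    · omega
  have key := f.producible_merge C (lobePoint ε j 0 (m * 3 ^ j)) v hbC ha ?_ ?_ (n + 1) ?_ ?_
  · refine hout (h.dom.dom_subset key (Assembly.mem_dom.2 ?_))
    rw [← hshift, ← hp, add_sub_cancel_right, if_pos ⟨u, y, hp, Or.inr ⟨rfl, rfl⟩⟩]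
    exact f.pos_ne_none n
  · rintro _ ⟨u₀, y₀, rfl, hz | ⟨rfl, rfl⟩⟩
    · obtain ⟨z0, z1, -, -, z2, z3⟩ := hZ _ _ hz
      rw [hshift]
      exact hae _ _ z0 z1 z2 z3
    -- The target of the last attachment is free because it lies outside the fractal.
    · rw [hshift]
      by_contra hne
      exact hout (h.dom.dom_subset ha (Assembly.mem_dom.2 hne))
  · rintro _ ⟨u₀, y₀, rfl, hz | ⟨rfl, rfl⟩⟩
    · obtain ⟨z0, -, z1, z2, -⟩ := hZ _ _ hz
      exact h.seed _ _ z0.le z1.le z2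
    · exact h.seed _ _ hu0.le huj hU.nonneg
  · intro k' hk' hne
    rw [hshift, sub_self, zero_add, hat, ← ht]
    have hn0 : f.asm n (lobePoint ε j 0 (m * 3 ^ j)) ≠ none := by rw [ht]; simp
    rw [← f.asm_mono (Nat.le_succ n) hn0]
    exact f.asm_mono hk' hne
  · rintro k' hk' ⟨u₀, y₀, e, hz⟩ d hd
    rcases hdep k' (by omega) u₀ y₀ e hz d hd with ⟨u', y', e', hz'⟩ | e'
    · exact Or.inl ⟨u', y', e', Or.inl hz'⟩
    · exact Or.inr e'

/-- A box can be left only at `u = repunit i + 1`. Up to that attachment the growth depends on the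
cut tile alone, so it can be replayed at scale `i`, where it would run into the hole of
`not_middle`. -/
theorem le_of_high (h : LobeGrowth f ε i j) {n : ℕ} (hc : ∀ k ≤ n, f.Confined ε i j k) {m u y : ℤ}
    (hm : m = 1 ∨ m = 2) (hsub : 𝒯.cutTiles ε m 1 j ⊆ 𝒯.cutTiles ε m 1 i)
    (hp : f.pos n = lobePoint ε j u y) (h0 : 0 < u) (h1 : u ≤ repunit i + 1)
    (h2 : m * 3 ^ j ≤ y) (h3 : y < m * 3 ^ j + 3 ^ i)
    (hb : f.asm n (lobePoint ε j 0 (m * 3 ^ j)) ≠ none) : u ≤ repunit i := by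
  obtain ⟨g0, g1, g2, g3, g4, g5⟩ := h.bounds
  have g6 := pow_three_lt (show 0 < i from h.pos)
  have g7 := pow_succ (3 : ℤ) i
  rw [pow_zero] at g6
  have hmj : 0 ≤ m * 3 ^ j ∧ m * 3 ^ j + 3 ^ i ≤ 3 ^ (j + 1) := by
    rcases hm with rfl | rfl <;> constructor <;> omega
  have hmi : 1 * 3 ^ i ≤ m * 3 ^ i ∧ m * 3 ^ i + 3 ^ i ≤ 3 ^ (i + 1) := by
    rcases hm with rfl | rfl <;> constructor <;> omega
  by_contra! hu
  obtain rfl : u = repunit i + 1 := by omega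
  obtain ⟨t, ht⟩ := Option.ne_none_iff_exists'.1 hb
  refine h.not_leave ht (hsub (h.mem_cutTiles_high hc ht))
    (fun u y => 0 < u ∧ HighZone i j m u y) hp h0 (by omega) (by omega)
    (LobeMem.not_middle (by omega) (by omega)) ?_ ?_
  · rintro u y ⟨z0, z1, z2, z3, z4⟩
    refine ⟨z0, ?_, ?_, ?_, ?_, ?_⟩ <;> omega
  · intro k hk u₀ y₀ hp' hz d hd
    have hz' : 0 < u₀ ∧ u₀ ≤ repunit i + 1 ∧ m * 3 ^ j ≤ y₀ ∧ y₀ < m * 3 ^ j + 3 ^ i := by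
      rcases hz with ⟨z0, z1, z2, z3, z4⟩ | ⟨rfl, rfl⟩ <;> omega
    obtain ⟨u', y', e, hn, hU', ⟨hl, -⟩ | ⟨m', hm', hz'', -, hy'⟩⟩ :=
      h.neighbor_zone (hc k hk) hp' hz'.1 (by omega) (by omega) (by omega) hd
    · exact (hl.not_near h.lt (by omega) hU' hn hz'.1.le hz'.2.1 hz'.2.2.1).elim
    · have := hz''.near h.lt hn hz'.1.le (h.lobeMem_pos hz'.1.le (by omega) hp')
      obtain rfl : m' = m := by
        rcases hm with rfl | rfl <;> rcases hm' with rfl | rfl <;> omega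
      rcases hz''.1.eq_or_lt with rfl | h0'
      · exact Or.inr (by rw [e, hy' rfl])
      · exact Or.inl ⟨u', y', e, h0', hz''⟩

/-- A first step up to height `3 ^ j` supported by low tiles alone could be replayed at scale `j'`.
It occurs at some `u ≤ repunit j`, and there lobe `j'` has a hole at that height. -/
theorem lt_of_low (h : LobeGrowth f ε i j) {n j' : ℕ} (hj' : j < j')
    (hc : ∀ k ≤ n, f.Confined ε i j k) {u y : ℤ}
    (hsub : 𝒯.cutTiles ε 0 0 j ⊆ 𝒯.cutTiles ε 0 0 j')
    (hp : f.pos n = lobePoint ε j u y) (h0 : 0 < u) (h1 : u < 3 ^ j)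
    (h2 : 0 ≤ y) (h3 : y ≤ 3 ^ j) (hb : f.asm n (lobePoint ε j 0 0) ≠ none)
    (hlow : ∀ d : Side, f.asm n (f.pos n + d.vec) ≠ none →
      ∃ u' y', f.pos n + d.vec = lobePoint ε j u' y' ∧ LowZone j u' y' ∧ (u' = 0 → y' = 0)) :
    y < 3 ^ j := by
  obtain ⟨g0, g1, g2, g3, g4, g5⟩ := h.bounds
  have g6 := pow_three_lt hj'
  have g7 := pow_succ (3 : ℤ) j'
  by_contra! hy
  obtain rfl : y = 3 ^ j := by omega
  have hU := h.lobeMem_pos h0.le h1.le hp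
  obtain ⟨t, ht⟩ := Option.ne_none_iff_exists'.1 hb
  have ht' : f.asm n (lobePoint ε j 0 (0 * 3 ^ j)) = some t := by rwa [zero_mul]
  refine h.not_leave ht' (hsub (h.mem_cutTiles_low hc ht'))
    (fun u y => 0 < u ∧ LowZone j u y) hp h0 h1.le (by omega) ?_ ?_ ?_
  · have := LobeMem.not_above (m := 0) hj' h0.le (hU.le_repunit h1)
    convert this using 1
    rw [zero_mul, zero_mul, sub_zero, add_zero, zero_add]
  · rintro u y ⟨z0, z1, z2, z3, z4⟩
    refine ⟨z0, ?_, ?_, ?_, ?_, ?_⟩ <;> omega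
  · intro k hk u₀ y₀ hp' hz d hd
    have low : ∀ u' y', f.pos k + d.vec = lobePoint ε j u' y' → LowZone j u' y' →
        (u' = 0 → y' = 0) → (∃ u' y', f.pos k + d.vec = lobePoint ε j u' y' ∧
          0 < u' ∧ LowZone j u' y') ∨ f.pos k + d.vec = lobePoint ε j 0 (0 * 3 ^ j) := by
      intro u' y' e hz hy'
      rcases hz.1.eq_or_lt with rfl | h0'
      · exact Or.inr (by rw [e, hy' rfl, zero_mul])
      · exact Or.inl ⟨u', y', e, h0', hz⟩
    rcases hz with ⟨z0, z1, z2, z3, z4⟩ | ⟨rfl, rfl⟩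
    · obtain ⟨u', y', e, hn, hU', ⟨hl, -, hy'⟩ | ⟨m', hm', hz'', -, hy'⟩⟩ :=
        h.neighbor_zone (hc k hk) hp' z0 z2 z3 (by omega) hd
      · exact low u' y' e hl hy'
      · have := hz''.near h.lt hn z1 (h.lobeMem_pos z1 (by omega) hp')
        rcases hm' with rfl | rfl <;> omega
    -- The exit point is filled only once, at time `n`, so `hlow` governs its neighbours.
    · have hkn : k = n := by
        by_contra hkn
        have := f.ne_none_mono (show k + 1 ≤ n by omega) (f.pos_ne_none k)
        rw [hp', ← hp, f.pos_none] at this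
        exact this rfl
      subst hkn
      obtain ⟨u', y', e, hz, hy'⟩ := hlow d hd
      exact low u' y' e hz hy'

theorem confined (h : LobeGrowth f ε i j) {j' : ℕ} (hj' : j < j')
    (hlow : 𝒯.cutTiles ε 0 0 j ⊆ 𝒯.cutTiles ε 0 0 j')
    (hhigh : ∀ m, m = 1 ∨ m = 2 → 𝒯.cutTiles ε m 1 j ⊆ 𝒯.cutTiles ε m 1 i) (n : ℕ) :
    f.Confined ε i j n := by
  obtain ⟨g0, g1, g2, g3, g4, g5⟩ := h.bounds
  induction n using Nat.strong_induction_on with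
  | _ n ih =>
    intro u y h0 h1 h2 h3 hne
    cases n with
    | zero =>
      rw [f.zero, h.seed u y h0.le h1.le h2] at hne
      exact absurd rfl hne
    | succ n =>
      have hc : ∀ k ≤ n, f.Confined ε i j k := fun k hk => ih k (by omega)
      have mono : ∀ {p}, f.asm n p ≠ none → f.asm (n + 1) p ≠ none :=
        fun hp => f.ne_none_mono (Nat.le_succ n) hp
      by_cases hp : lobePoint ε j u y = f.pos n
      · replace hp := hp.symm
        have hU := h.lobeMem_pos h0.le h1.le hp
        -- An attachment touching a box must stay in that box; otherwise all its neighbours are low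
        -- tiles, and it must stay low.
        by_cases hex : ∃ m u' y', (m = 1 ∨ m = 2) ∧ Near u y u' y' ∧ HighZone i j m u' y' ∧
            f.asm n (lobePoint ε j 0 (m * 3 ^ j)) ≠ none
        · obtain ⟨m, u', y', hm, hn, hz, hb⟩ := hex
          obtain ⟨z1, z2, z3⟩ := hz.near h.lt hn h0.le hU
          exact Or.inr ⟨m, hm, ⟨h0.le, h.le_of_high hc hm (hhigh m hm) hp h0 z1 z2 z3 hb, z2, z3⟩,
            mono hb⟩
        · have hall : ∀ d : Side, f.asm n (f.pos n + d.vec) ≠ none →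
              ∃ u' y', f.pos n + d.vec = lobePoint ε j u' y' ∧ Near u y u' y' ∧
                LowZone j u' y' ∧ f.asm n (lobePoint ε j 0 0) ≠ none ∧ (u' = 0 → y' = 0) := by
            intro d hd
            obtain ⟨u', y', e, hn, -, hl | ⟨m, hm, hz, hb, -⟩⟩ :=
              h.neighbor_zone (hc n le_rfl) hp h0 h1 h2 h3 hd
            · exact ⟨u', y', e, hn, hl⟩
            · exact absurd ⟨m, u', y', hm, hn, hz, hb⟩ hex
          obtain ⟨d, hd⟩ := f.exists_neighbor h.temp n
          obtain ⟨u', y', -, hn, hz, hb, -⟩ := hall d hd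
          have hy : y ≤ 3 ^ j := by
            have := hz.2.2.2
            unfold Near at hn; omega
          refine Or.inl ⟨⟨h0.le, h1, h2, ?_⟩, mono hb⟩
          refine h.lt_of_low hj' hc hlow hp h0 h1 h2 hy hb fun d hd => ?_
          obtain ⟨u', y', e, -, hz, -, hy'⟩ := hall d hd
          exact ⟨u', y', e, hz, hy'⟩
      · rw [f.asm_succ_of_ne hp] at hne
        rcases hc n le_rfl u y h0 h1 h2 h3 hne with ⟨hz, hb⟩ | ⟨m, hm, hz, hb⟩
        · exact Or.inl ⟨hz, mono hb⟩
        · exact Or.inr ⟨m, hm, hz, mono hb⟩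

theorem false_of_cutTiles_subset (h : LobeGrowth f ε i j)
    (hf : ∀ p ∈ DSSF.uFractal, ∃ n, f.asm n p ≠ none) {j' : ℕ} (hj' : j < j')
    (hlow : 𝒯.cutTiles ε 0 0 j ⊆ 𝒯.cutTiles ε 0 0 j')
    (hhigh : ∀ m, m = 1 ∨ m = 2 → 𝒯.cutTiles ε m 1 j ⊆ 𝒯.cutTiles ε m 1 i) : False := by
  obtain ⟨g0, g1, g2, g3, g4, g5⟩ := h.bounds
  have g6 := two_mul_repunit j
  obtain ⟨n, hn⟩ := hf _ ((lobePoint_mem h.sign (repunit_nonneg j) (by omega)).2 (LobeMem.corner j))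
  rcases h.confined hj' hlow hhigh n _ _ (by omega) (by omega) (by positivity) (by omega) hn with
    ⟨hz, -⟩ | ⟨m, -, hz, -⟩
  · exact lt_irrefl _ hz.2.2.2
  · have := hz.2.1
    omega

end LobeGrowth

/-- The tile at the shared gate needs a neighbour to bind to. The points above and below are outside
the fractal, so this neighbour lies in one of the two lobes. -/
theorem exists_side (f : Growth 𝒯) (h : 𝒯.FinitelySelfAssembles DSSF.uFractal)
    (ht : 0 < 𝒯.temp) (hf : ∀ p ∈ DSSF.uFractal, ∃ n, f.asm n p ≠ none) {j : ℕ}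
    (hseed : 𝒯.seed (lobePoint 1 j (3 ^ j) 0) = none) :
    ∃ ε : ℤ, (ε = 1 ∨ ε = -1) ∧ ∃ n, f.pos n = lobePoint ε j (3 ^ j) 0 ∧
      f.asm n (lobePoint ε j (3 ^ j - 1) 0) ≠ none := by
  have hp : (0 : ℤ) < 3 ^ j := by positivity
  obtain ⟨N, hN⟩ := hf _ ((lobePoint_mem (Or.inl rfl) hp.le le_rfl).2 (LobeMem.right_zero j))
  obtain ⟨n, -, hn⟩ := f.exists_pos_eq hseed hN
  have hcut : ∀ ε : ℤ, f.pos n = lobePoint ε j (3 ^ j) 0 := by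
    intro ε; rw [hn]; simp [lobePoint]
  obtain ⟨d, hd⟩ := f.exists_neighbor ht n
  have vertical : ∀ y : ℤ, y < 3 ^ (j + 1) →
      f.asm n (lobePoint 1 j (3 ^ j) y) ≠ none → y = 0 := fun y hy hne =>
    ((lobePoint_mem (Or.inl rfl) hp.le le_rfl).1 (f.mem_of_ne_none h hne)).eq_zero_of_right hy
  have h1 : (1 : ℤ) < 3 ^ (j + 1) := one_lt_pow₀ (by norm_num) (by omega)
  rw [hn] at hd
  cases d with
  | north =>
    have := vertical 1 h1 (by simpa [lobePoint, Side.vec] using hd)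
    omega
  | south =>
    have := vertical (-1) (by omega) (by simpa [lobePoint, Side.vec] using hd)
    omega
  | east => exact ⟨-1, Or.inr rfl, n, hcut _, by simpa [lobePoint, Side.vec] using hd⟩
  | west => exact ⟨1, Or.inl rfl, n, hcut _, by simpa [lobePoint, Side.vec] using hd⟩

end Growth

theorem exists_seed_bound (𝒯 : TAS L) : ∃ J : ℕ, ∀ j ≥ J, ∀ ε : ℤ, (ε = 1 ∨ ε = -1) → ∀ u y,
    0 ≤ u → u ≤ 3 ^ j → 𝒯.seed (lobePoint ε j u y) = none := by
  obtain ⟨B, hB⟩ := (𝒯.seed_stable.1.image Prod.fst).bddAbove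
  refine ⟨B.toNat, fun j hj ε hε u y h0 h1 => ?_⟩
  by_contra hne
  have h2 := hB ⟨_, Assembly.mem_dom.2 hne, rfl⟩
  have h3 : ((j + 1 : ℕ) : ℤ) < 3 ^ (j + 1) := by
    exact_mod_cast Nat.lt_pow_self (by norm_num : 1 < 3)
  have h4 := repunit_nonneg j
  simp only [lobePoint, repunit] at h2
  rcases hε with rfl | rfl <;> omega

end TAS

/-! ### Choice of the scales by pigeonhole -/

theorem theorem2 {L : Type*} (𝒯 : TAS L) : ¬ 𝒯.FinitelySelfAssembles DSSF.uFractal := by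
  intro h
  have hout : ((-1, 0) : ℤ × ℤ) ∉ DSSF.uFractal := fun hm => by
    have := (DSSF.mem_uFractal.1 hm).1
    norm_num at this
  have ht := h.temp_pos DSSF.infinite_uFractal hout
  obtain ⟨f, hf⟩ := h.exists_growth DSSF.infinite_uFractal
  obtain ⟨J, hJ⟩ := 𝒯.exists_seed_bound
  have side : ∀ k : ℕ, ∃ ε : ({1, -1} : Finset ℤ), ∃ n,
      f.pos n = lobePoint ε (J + k) (3 ^ (J + k)) 0 ∧
        f.asm n (lobePoint ε (J + k) (3 ^ (J + k) - 1) 0) ≠ none := by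
    intro k
    obtain ⟨ε, hε, hn⟩ := f.exists_side h ht hf (j := J + k)
      (hJ _ (by omega) 1 (Or.inl rfl) _ _ (by positivity) le_rfl)
    exact ⟨⟨ε, by simpa using hε⟩, hn⟩
  choose ε hε using side
  -- There are finitely many tile types, hence finitely many values of the side and of the three
  -- sets of cut tiles.
  obtain ⟨⟨ε₀, X, Y, Z⟩, hinf⟩ := Finite.exists_infinite_fiber fun k : ℕ =>
    (ε k, 𝒯.cutTiles (ε k) 0 0 (J + k), 𝒯.cutTiles (ε k) 1 1 (J + k),
      𝒯.cutTiles (ε k) 2 1 (J + k))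
  rw [Set.infinite_coe_iff] at hinf
  obtain ⟨i, hi, hi0⟩ := hinf.exists_gt 0
  -- Exceeding `i + 1` provides the gap of two scales that `not_below` requires.
  obtain ⟨j, hj, hij⟩ := hinf.exists_gt (i + 1)
  obtain ⟨k, hk, hjk⟩ := hinf.exists_gt j
  simp only [Set.mem_preimage, Set.mem_singleton_iff, Prod.mk.injEq] at hi hj hk
  obtain ⟨rfl, i0, i1, i2⟩ := hi
  obtain ⟨je, j0, j1, j2⟩ := hj
  obtain ⟨ke, k0, k1, k2⟩ := hk
  have hsign : (ε i : ℤ) = 1 ∨ (ε i : ℤ) = -1 := by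
    have := (ε i).2
    rwa [Finset.mem_insert, Finset.mem_singleton] at this
  have hside := hε j
  rw [je] at hside j0 j1 j2
  rw [ke] at k0
  have hg : f.LobeGrowth (ε i) (J + i) (J + j) :=
    ⟨hsign, by omega, by omega, ht, h,
      fun u y h0 h1 _ => hJ _ (by omega) _ hsign u y h0 h1, hside⟩
  refine hg.false_of_cutTiles_subset hf (j' := J + k) (by omega) (j0.trans k0.symm).subset ?_
  rintro m (rfl | rfl)
  · exact (j1.trans i1.symm).subset
  · exact (j2.trans i2.symm).subset
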